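/- Let $K$ be an algebraically closed field, $B$ a finite-dimensional (associative, unital) $K$-algebra, $(\Lambda,\le)$ a finite poset with $n$ elements, $o\in\Lambda$ (usually written $1$), and $(L(i))_{i\in\Lambda}$ a family of two-sided ideals of $B$. Assume that $(B,L)$, with $L\cong\bigoplus_{i\in\Lambda}L(i)$ as a left $B$-module, satisfies the condition $[\le]$, that is: $B$ is local and self-injective, $\dim_K B=n$, $L(o)=B$, every $L(i)$ is local as a left $B$-module (its radical is a maximal submodule), and for all $i,j\in\Lambda$ (a) there is a surjective $B$-linear map $L(i)\to L(j)$ if and only if $i\le j$; (b) $\operatorname{rad}L(i)=\sum_{j>i}L(j)$. Let $A$ be a $K$-algebra with $A\cong\operatorname{End}_B(L)^{op}$, where the product of $\operatorname{End}_B(L)^{op}$ is by convention $F\cdot G=F\circ G$ (first $G$, then $F$). (These algebras $A$ are the 1-quasi-hereditary algebras; this fact is not part of the statement.) Let $Q$ be the quiver with vertex set $\Lambda$ that has exactly one arrow $i\to j$ and exactly one arrow $j\to i$ whenever $j$ covers $i$, and no other arrows. Let $KQ$ be its path algebra, where $p\cdot q$ is the path "first $q$, then $p$", and for a path $p$ let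 $\mathfrak o(p)$ be the path through the same vertices in the opposite direction. Fix generators $x_i$ of the left ideals $L(i)=Bx_i$ with $x_o=1$. Let $\psi:KQ\to A$ be the algebra homomorphism that sends the trivial path at $i$ to the projection of $L$ onto $L(i)$, an arrow $i\to j$ where $j$ covers $i$ to the unique $B$-linear map $L(i)\to L(j)$ with $x_i\mapsto x_j$ (right multiplication by some $b\in B$ with $x_ib=x_j$), and an arrow $i\to j$ where $i$ covers $j$ to the inclusion $L(i)\subseteq L(j)$. Put $I=\ker\psi$. Then $\psi$ is surjective, so that $A\cong KQ/I$, and the following are equivalent: (i) $B$ is commutative; (ii) the $K$-linear map $KQ\to KQ$ with $p\mapsto\mathfrak o(p)$ for all paths $p$ induces an anti-automorphism $\sigma$ of $A$ (a $K$-linear map with $\sigma(aa')=\sigma(a')\sigma(a)$ and $\sigma(\sigma(a))=a$ for all $a,a'\in A$); that is, $A$ is a $\mathrm{BGG}_{(\leftrightarrows)}$-algebra; (iii) for all $r\ge 0$, all $c_1,\dots,c_r\in K$ and all paths $p_1,\dots,p_r$ of $Q$: $\sum_{t=1}^r c_t\,p_t\in I$ if and only if $\sum_{t=1}^r c_t\,\mathfrak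 o(p_t)\in I$. -/

import Mathlib

namespace BGGReversal

/-! ### The path algebra of a finite quiver -/

section PathAlgebra

open Quiver

variable (K : Type*) [Field K] (V : Type*) [Quiver V]

/-- A path of the quiver `V`, together with its source and its target. -/
abbrev AnyPath : Type _ := Σ i : V, Σ j : V, Path i j

/-- The path algebra `KQ` of the quiver `Q = V`: its elements are the finite formal
`K`-linear combinations of paths. -/
def PathAlgebra : Type _ := AnyPath V →₀ K

namespace PathAlgebra

noncomputable instance : AddCommGroup (PathAlgebra K V) :=
  inferInstanceAs (AddCommGroup (AnyPath V →₀ K))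

noncomputable instance : Module K (PathAlgebra K V) :=
  inferInstanceAs (Module K (AnyPath V →₀ K))

/-- The basis of `KQ` that consists of the paths. -/
noncomputable def basis : Module.Basis (AnyPath V) K (PathAlgebra K V) :=
  Module.Basis.ofRepr (LinearEquiv.refl K (AnyPath V →₀ K))

variable {V} in
/-- A path, as an element of `KQ`. -/
noncomputable def ofPath (p : AnyPath V) : PathAlgebra K V := basis K V p

open Classical in
variable {V} in
/-- The product `p · q` of two paths is the path "first `q`, then `p`" if `q` ends where `p`
starts, and `0` otherwise. -/
noncomputable def mulPath (p q : AnyPath V) : PathAlgebra K V :=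
  if h : q.2.1 = p.1 then ofPath K ⟨q.1, p.2.1, (q.2.2.cast rfl h).comp p.2.2⟩ else 0

/-- The multiplication of `KQ`, as a bilinear map. -/
noncomputable def mulLin : PathAlgebra K V →ₗ[K] PathAlgebra K V →ₗ[K] PathAlgebra K V :=
  (basis K V).constr K fun p => (basis K V).constr K fun q => mulPath K p q

noncomputable instance : Mul (PathAlgebra K V) := ⟨fun a b => mulLin K V a b⟩

/-- The unit of `KQ` is the sum of the paths of length `0`. -/
noncomputable instance [Fintype V] : One (PathAlgebra K V) :=
  ⟨∑ i : V, ofPath K ⟨i, i, Path.nil⟩⟩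

variable {K V}

theorem mul_def (a b : PathAlgebra K V) : a * b = mulLin K V a b := rfl

theorem one_def [Fintype V] :
    (1 : PathAlgebra K V) = ∑ i : V, ofPath K ⟨i, i, Path.nil⟩ := rfl

theorem ofPath_mul_ofPath (p q : AnyPath V) : ofPath K p * ofPath K q = mulPath K p q := by
  simp [mul_def, mulLin, ofPath]

theorem mulPath_comp {i j k : V} (p : Path j k) (q : Path i j) :
    mulPath K ⟨j, k, p⟩ ⟨i, j, q⟩ = ofPath K ⟨i, k, q.comp p⟩ := by
  simp [mulPath]

theorem mulPath_of_ne {p q : AnyPath V} (h : q.2.1 ≠ p.1) : mulPath K p q = 0 := by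
  simp [mulPath, h]

theorem mul_assoc_path (p q r : AnyPath V) :
    mulLin K V (mulLin K V (ofPath K p) (ofPath K q)) (ofPath K r) =
      mulLin K V (ofPath K p) (mulLin K V (ofPath K q) (ofPath K r)) := by
  simp only [← mul_def, ofPath_mul_ofPath]
  obtain ⟨a, b, p⟩ := p
  obtain ⟨c, d, q⟩ := q
  obtain ⟨e, f, r⟩ := r
  by_cases h1 : d = a
  · subst h1
    by_cases h2 : f = c
    · subst h2
      simp only [mulPath_comp, ofPath_mul_ofPath, Path.comp_assoc]
    · rw [mulPath_comp, mulPath_of_ne (p := ⟨c, d, q⟩) h2, ofPath_mul_ofPath,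
        mulPath_of_ne (by exact h2)]
      simp [mul_def]
  · rw [mulPath_of_ne (p := ⟨a, b, p⟩) (q := ⟨c, d, q⟩) h1]
    by_cases h2 : f = c
    · subst h2
      rw [mulPath_comp, ofPath_mul_ofPath, mulPath_of_ne (by exact h1)]
      simp [mul_def]
    · rw [mulPath_of_ne (p := ⟨c, d, q⟩) (q := ⟨e, f, r⟩) h2]
      simp [mul_def]

theorem one_mul_path [Fintype V] (p : AnyPath V) :
    (1 : PathAlgebra K V) * ofPath K p = ofPath K p := by
  obtain ⟨a, b, p⟩ := p
  rw [one_def, mul_def, map_sum, LinearMap.sum_apply]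
  simp only [← mul_def, ofPath_mul_ofPath]
  rw [Finset.sum_eq_single b]
  · simp [mulPath_comp]
  · intro c _ hc
    exact mulPath_of_ne (by exact hc.symm)
  · simp

theorem path_mul_one [Fintype V] (p : AnyPath V) :
    ofPath K p * (1 : PathAlgebra K V) = ofPath K p := by
  obtain ⟨a, b, p⟩ := p
  rw [one_def, mul_def, map_sum]
  simp only [← mul_def, ofPath_mul_ofPath]
  rw [Finset.sum_eq_single a]
  · simp [mulPath_comp]
  · intro c _ hc
    exact mulPath_of_ne (by exact hc)
  · simp

theorem induction_paths {C : PathAlgebra K V → Prop} (x : PathAlgebra K V) (zero : C 0)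
    (add : ∀ a b, C a → C b → C (a + b)) (smul : ∀ (c : K) p, C (c • ofPath K p)) : C x := by
  have hx : x ∈ Submodule.span K (Set.range (basis K V)) := by
    rw [(basis K V).span_eq]; trivial
  rw [← Finsupp.range_linearCombination] at hx
  obtain ⟨f, rfl⟩ := hx
  induction f using Finsupp.induction_linear with
  | zero => simpa using zero
  | add f g hf hg => rw [map_add]; exact add _ _ hf hg
  | single p c => rw [Finsupp.linearCombination_single]; exact smul c p

theorem mulLin_assoc (a b c : PathAlgebra K V) :
    mulLin K V (mulLin K V a b) c = mulLin K V a (mulLin K V b c) := by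
  induction a using induction_paths with
  | zero => simp
  | add a a' h h' => simp only [map_add, LinearMap.add_apply, h, h']
  | smul r p =>
    induction b using induction_paths with
    | zero => simp
    | add b b' h h' => simp only [map_add, LinearMap.add_apply, h, h']
    | smul s q =>
      induction c using induction_paths with
      | zero => simp
      | add c c' h h' => simp only [map_add, h, h']
      | smul t u => simp only [map_smul, LinearMap.smul_apply, mul_assoc_path]

theorem mulLin_one [Fintype V] (a : PathAlgebra K V) : mulLin K V a 1 = a := by
  induction a using induction_paths with
  | zero => simp
  | add a a' h h' => simp only [map_add, LinearMap.add_apply, h, h']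
  | smul r p => simpa [mul_def] using congrArg (r • ·) (path_mul_one (K := K) p)

theorem one_mulLin [Fintype V] (a : PathAlgebra K V) : mulLin K V 1 a = a := by
  induction a using induction_paths with
  | zero => simp
  | add a a' h h' => simp only [map_add, h, h']
  | smul r p => simpa [mul_def] using congrArg (r • ·) (one_mul_path (K := K) p)

noncomputable instance [Fintype V] : Ring (PathAlgebra K V) where
  left_distrib a b c := map_add (mulLin K V a) b c
  right_distrib a b c := LinearMap.map_add₂ (mulLin K V) a b c
  zero_mul a := LinearMap.map_zero₂ (mulLin K V) a
  mul_zero a := map_zero (mulLin K V a)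
  mul_assoc := mulLin_assoc
  one_mul := one_mulLin
  mul_one := mulLin_one
  zsmul := (· • ·)
  zsmul_zero' := SubNegMonoid.zsmul_zero'
  zsmul_succ' := SubNegMonoid.zsmul_succ'
  zsmul_neg' := SubNegMonoid.zsmul_neg'
  nsmul := (· • ·)
  nsmul_zero := AddMonoid.nsmul_zero
  nsmul_succ := AddMonoid.nsmul_succ
  neg_add_cancel := neg_add_cancel
  sub_eq_add_neg := sub_eq_add_neg

noncomputable instance [Fintype V] : Algebra K (PathAlgebra K V) :=
  Algebra.ofModule (fun r a b => LinearMap.map_smul₂ (mulLin K V) r a b)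
    (fun r a b => map_smul (mulLin K V a) r b)

end PathAlgebra

variable {V} in
/-- The opposite path `𝔬(p)`, which runs through the vertices of `p` in the opposite direction. -/
def oppPath [HasReverse V] (p : AnyPath V) : AnyPath V :=
  ⟨p.2.1, p.1, p.2.2.reverse⟩

/-- The `K`-linear map `ε : KQ → KQ` with `ε(p) = 𝔬(p)` for all paths `p`. -/
noncomputable def reversal [HasReverse V] : PathAlgebra K V →ₗ[K] PathAlgebra K V :=
  (PathAlgebra.basis K V).constr K fun p => PathAlgebra.ofPath K (oppPath p)

variable {K V} in
/-- For a presentation `ψ : KQ → A`, the map `ε` of `KQ` induces an anti-automorphism of `A`: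
a `K`-linear map `σ : A → A` with `σ(a a') = σ(a') σ(a)`, `σ(σ(a)) = a` and
`σ(ψ(ρ)) = ψ(ε(ρ))`. -/
def ReversalInducesAntiAutomorphism [Fintype V] [HasReverse V] {A : Type*} [Ring A] [Algebra K A]
    (ψ : PathAlgebra K V →ₐ[K] A) : Prop :=
  ∃ σ : A →ₗ[K] A, (∀ a a' : A, σ (a * a') = σ a' * σ a) ∧ (∀ a : A, σ (σ a) = a) ∧
    ∀ ρ : PathAlgebra K V, σ (ψ ρ) = ψ (reversal K V ρ)

end PathAlgebra

/-! ### The algebra map given by a representation of a quiver -/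

section Representation

open Quiver

variable (K : Type*) [Field K] {B : Type*} [Ring B] [Algebra K B] {V : Type*} [Quiver V]
  {M : V → Type*} [∀ i, AddCommGroup (M i)] [∀ i, Module B (M i)]
  [∀ i, Module K (M i)] [∀ i, IsScalarTower K B (M i)]

/-- The composition of the maps attached to the arrows of a path. -/
def pathMap (f : ∀ i j : V, (i ⟶ j) → (M i →ₗ[B] M j)) {i : V} :
    ∀ {j : V}, Path i j → (M i →ₗ[B] M j)
  | _, Path.nil => LinearMap.id
  | _, Path.cons p a => (f _ _ a).comp (pathMap f p)

theorem pathMap_comp (f : ∀ i j : V, (i ⟶ j) → (M i →ₗ[B] M j)) {i j k : V} (p : Path i j)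
    (q : Path j k) : pathMap f (p.comp q) = (pathMap f q).comp (pathMap f p) := by
  induction q with
  | nil => rfl
  | cons q a ih => simp only [Path.comp_cons, pathMap, ih, LinearMap.comp_assoc]

variable [DecidableEq V] [Fintype V]

/-- The endomorphism of the finite direct sum `⨁ i, M i` that a path from `i` to `j` induces: it
is the map of the path on `M i`, followed by the inclusion of `M j`, and `0` on the other
summands. -/
def pathEnd (f : ∀ i j : V, (i ⟶ j) → (M i →ₗ[B] M j)) (p : AnyPath V) :
    Module.End B ((i : V) → M i) :=
  (LinearMap.single B M p.2.1).comp ((pathMap f p.2.2).comp (LinearMap.proj p.1))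

/-- The `K`-linear extension of `pathEnd` to `KQ`. -/
noncomputable def evalLin (f : ∀ i j : V, (i ⟶ j) → (M i →ₗ[B] M j)) :
    PathAlgebra K V →ₗ[K] Module.End B ((i : V) → M i) :=
  (PathAlgebra.basis K V).constr K (pathEnd f)

theorem evalLin_ofPath (f : ∀ i j : V, (i ⟶ j) → (M i →ₗ[B] M j)) (p : AnyPath V) :
    evalLin K f (PathAlgebra.ofPath K p) = pathEnd f p := by
  simp [evalLin, PathAlgebra.ofPath]

theorem evalLin_one (f : ∀ i j : V, (i ⟶ j) → (M i →ₗ[B] M j)) : evalLin K f 1 = 1 := by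
  rw [PathAlgebra.one_def, map_sum]
  simp only [evalLin_ofPath]
  ext i m j
  simp [pathEnd, pathMap, Finset.sum_apply]

theorem evalLin_mul (f : ∀ i j : V, (i ⟶ j) → (M i →ₗ[B] M j)) (a b : PathAlgebra K V) :
    evalLin K f (a * b) = evalLin K f a * evalLin K f b := by
  induction a using PathAlgebra.induction_paths with
  | zero => simp
  | add a a' h h' => simp only [add_mul, map_add, h, h']
  | smul r p =>
    induction b using PathAlgebra.induction_paths with
    | zero => simp
    | add b b' h h' => simp only [mul_add, map_add, h, h']
    | smul s q =>
      simp only [smul_mul_assoc, mul_smul_comm, map_smul, PathAlgebra.ofPath_mul_ofPath,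
        evalLin_ofPath]
      congr 2
      obtain ⟨i, j, p⟩ := p
      obtain ⟨k, l, q⟩ := q
      by_cases h : l = i
      · subst h
        rw [PathAlgebra.mulPath_comp, evalLin_ofPath]
        refine LinearMap.ext fun m => ?_
        simp [pathEnd, pathMap_comp]
      · rw [PathAlgebra.mulPath_of_ne (by exact h), map_zero]
        refine LinearMap.ext fun m => ?_
        simp [pathEnd, Pi.single_eq_of_ne (Ne.symm h)]

/-- The algebra map `KQ → End_B(⨁ i, M i)` that a representation of the quiver induces.
Multiplication in `Module.End` is `F * G = F ∘ G`, in accordance with the product of paths. -/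
noncomputable def evalHom (f : ∀ i j : V, (i ⟶ j) → (M i →ₗ[B] M j)) :
    PathAlgebra K V →ₐ[K] Module.End B ((i : V) → M i) :=
  AlgHom.ofLinearMap (evalLin K f) (evalLin_one K f) (evalLin_mul K f)

/-- The algebra map `KQ → A` that a representation of the quiver induces, for an algebra `A` with
`A ≅ End_B(L)ᵒᵖ`, `L ≅ ⨁ i, M i`. The product of `End_B(L)ᵒᵖ` is understood to be `F ∘ G`
(first `G`, then `F`), which is the product of `Module.End B L`. -/
noncomputable def presentationOf (f : ∀ i j : V, (i ⟶ j) → (M i →ₗ[B] M j))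
    {L : Type*} [AddCommGroup L] [Module B L] [Module K L] [IsScalarTower K B L]
    (eL : L ≃ₗ[B] ((i : V) → M i))
    {A : Type*} [Ring A] [Algebra K A] (eA : A ≃ₐ[K] Module.End B L) :
    PathAlgebra K V →ₐ[K] A :=
  (eA.trans (eL.conjAlgEquiv K)).symm.toAlgHom.comp (evalHom K f)

end Representation

/-! ### The condition on the pair `(B, L)` -/

section Condition

variable {B : Type*} [Ring B] {Λ : Type*}

/-- A choice of generators `x i` of the left ideals `J i`, with `x 1 = 1`. -/
structure Generators (J : Λ → Ideal B) (o : Λ) where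
  /-- the generators -/
  x : Λ → B
  span_eq : ∀ i, Ideal.span {x i} = J i
  x_one : x o = 1

theorem Generators.mem {J : Λ → Ideal B} {o : Λ} (g : Generators J o) (i : Λ) : g.x i ∈ J i := by
  rw [← g.span_eq i]; exact Ideal.mem_span_singleton_self _

variable (K : Type*) [Field K] [Algebra K B] [Fintype Λ] [PartialOrder Λ]

/-- The condition `[≤]` on the pair `(B, ⨁ i, J i)`, for a family `J` of left ideals of `B` that
is indexed by the poset `Λ`; the vertex `o` of `Λ` is the one that the literature calls `1`. -/
structure SatisfiesLE (J : Λ → Ideal B) (o : Λ) : Prop where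
  /-- `B` is local -/
  isLocalRing : IsLocalRing B
  /-- `B` is self-injective -/
  selfInjective : Module.Injective B B
  /-- the dimension of `B` is the number of elements of `Λ` -/
  finrank_eq : Module.finrank K B = Fintype.card Λ
  /-- the left ideals `J i` are two-sided -/
  isTwoSided : ∀ i, (J i).IsTwoSided
  /-- the ideals `J i` are local: the radical is a maximal submodule -/
  isLocal : ∀ i, IsCoatom (Module.jacobson B (J i))
  /-- `L(1) = B` -/
  eq_top : J o = ⊤
  /-- there is a surjection `J i → J j` if and only if `i ≤ j` -/
  surjective_iff : ∀ i j, (∃ f : J i →ₗ[B] J j, Function.Surjective f) ↔ i ≤ j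
  /-- the radical of `J i` is the sum of the `J j` with `i < j` -/
  radical_eq : ∀ i, (Module.jacobson B (J i)).map (J i).subtype = ⨆ j, ⨆ _ : i < j, J j

variable {K} {J : Λ → Ideal B} {o : Λ}

namespace SatisfiesLE

theorem le_of_le (h : SatisfiesLE K J o) {i j : Λ} (hij : i ≤ j) : J j ≤ J i := by
  rcases hij.eq_or_lt with rfl | hlt
  · exact le_rfl
  · calc J j ≤ ⨆ j, ⨆ _ : i < j, J j := le_iSup₂_of_le j hlt le_rfl
      _ = (Module.jacobson B (J i)).map (J i).subtype := (h.radical_eq i).symm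
      _ ≤ J i := Submodule.map_subtype_le _ _

/-- A non-unit of `B` maps a generator of `J i` into the radical. -/
theorem smul_mem_radical [FiniteDimensional K B] (h : SatisfiesLE K J o) {i : Λ} {y r : B}
    (hy : Ideal.span {y} = J i) (hr : ¬ IsUnit r) : r * y ∈ ⨆ j, ⨆ _ : i < j, J j := by
  have hloc := h.isLocalRing
  have hyi : y ∈ J i := by rw [← hy]; exact Ideal.mem_span_singleton_self _
  rw [← h.radical_eq i]
  refine ⟨⟨r * y, (J i).mul_mem_left r hyi⟩, ?_, rfl⟩
  by_contra hn
  set N := Module.jacobson B (J i) with hN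
  set ry : J i := ⟨r * y, (J i).mul_mem_left r hyi⟩ with hry
  have htop : N ⊔ Submodule.span B {ry} = ⊤ := by
    refine (h.isLocal i).2 _ (lt_of_le_of_ne le_sup_left fun e => hn ?_)
    have : ry ∈ N ⊔ Submodule.span B {ry} :=
      Submodule.mem_sup_right (Submodule.mem_span_singleton_self ry)
    rwa [← e] at this
  have hymem : (⟨y, hyi⟩ : J i) ∈ N ⊔ Submodule.span B {ry} := by rw [htop]; trivial
  obtain ⟨n, hn1, z, hz, hnz⟩ := Submodule.mem_sup.1 hymem
  obtain ⟨s, rfl⟩ := Submodule.mem_span_singleton.1 hz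
  have e1 : (n : B) = (1 - s * r) * y := by
    have e := congrArg Subtype.val hnz
    simp only [Submodule.coe_add, Submodule.coe_smul, hry, smul_eq_mul] at e
    rw [sub_mul, one_mul, mul_assoc, eq_sub_iff_add_eq, e]
  rcases IsLocalRing.isUnit_or_isUnit_of_add_one (a := 1 - s * r) (b := s * r) (by simp)
    with hu | hu
  · obtain ⟨u, hu⟩ := hu
    apply (h.isLocal i).1
    rw [eq_top_iff]
    rintro ⟨w, hw⟩ -
    have hw' := hw
    rw [← hy] at hw'
    obtain ⟨c, rfl⟩ := Ideal.mem_span_singleton'.1 hw'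
    have : (⟨c * y, hw⟩ : J i) = (c * (↑u⁻¹ : B)) • n := by
      apply Subtype.ext
      simp only [Submodule.coe_smul, smul_eq_mul, e1, ← hu]
      rw [mul_assoc, ← mul_assoc (↑u⁻¹ : B), Units.inv_mul, one_mul]
    rw [this]
    exact N.smul_mem _ hn1
  · apply hr
    obtain ⟨u, hu⟩ := hu
    have hl : ((↑u⁻¹ : B) * s) * r = 1 := by rw [mul_assoc, ← hu, Units.inv_mul]
    have : IsArtinianRing B := IsArtinianRing.of_finite K B
    exact IsUnit.of_mul_eq_one _ (mul_eq_one_symm hl)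

/-- If `y k` generates `J k` for all `k ≥ i`, then these `y k` span the `K`-space `J i`. -/
theorem mem_span [IsAlgClosed K] [FiniteDimensional K B] (h : SatisfiesLE K J o) {i : Λ}
    {y : Λ → B} (hy : ∀ k, i ≤ k → Ideal.span {y k} = J k) {z : B} (hz : z ∈ J i) :
    z ∈ Submodule.span K (y '' Set.Ici i) := by
  induction i using WellFoundedGT.induction generalizing z with
  | ind i ih =>
    have hloc := h.isLocalRing
    rw [← hy i le_rfl] at hz
    obtain ⟨c, rfl⟩ := Ideal.mem_span_singleton'.1 hz
    obtain ⟨l, hl⟩ := spectrum.nonempty_of_isAlgClosed_of_finiteDimensional K c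
    have hr : ¬ IsUnit (algebraMap K B l - c) := hl
    have hmem := h.smul_mem_radical (hy i le_rfl) hr
    have hle : ∀ w ∈ ⨆ j, ⨆ _ : i < j, J j, w ∈ Submodule.span K (y '' Set.Ici i) := by
      intro w hw
      rw [iSup_subtype'] at hw
      induction hw using Submodule.iSup_induction' with
      | mem k w hw =>
        refine Submodule.span_mono (Set.image_mono (Set.Ici_subset_Ici.2 k.2.le)) ?_
        exact ih k k.2 (fun m hm => hy m (k.2.le.trans hm)) hw
      | zero => exact Submodule.zero_mem _
      | add a b _ _ ha hb => exact Submodule.add_mem _ ha hb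
    have e : c * y i = l • y i - (algebraMap K B l - c) * y i := by
      rw [sub_mul, Algebra.smul_def]; abel
    rw [e]
    exact Submodule.sub_mem _
      (Submodule.smul_mem _ _ (Submodule.subset_span ⟨i, Set.self_mem_Ici, rfl⟩)) (hle _ hmem)

/-- For `i ≤ j` there is `b ∈ B` with `x i · b = x j`. -/
theorem exists_mul_eq [IsAlgClosed K] [FiniteDimensional K B] (h : SatisfiesLE K J o)
    (g : Generators J o) {i j : Λ} (hij : i ≤ j) : ∃ b : B, g.x i * b = g.x j := by
  have hinj := h.selfInjective
  have hex : ∀ k, i ≤ k → ∃ b : B, Ideal.span {g.x i * b} = J k := by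
    intro k hk
    obtain ⟨f, hf⟩ := (h.surjective_iff i k).2 hk
    obtain ⟨F, hF⟩ := hinj.out (J i).subtype Subtype.val_injective ((J k).subtype.comp f)
    have hx : g.x i * F 1 = f ⟨g.x i, g.mem i⟩ := by
      have := hF ⟨g.x i, g.mem i⟩
      simp only [Submodule.subtype_apply, LinearMap.comp_apply] at this
      rw [← this, ← smul_eq_mul, ← map_smul, smul_eq_mul, mul_one]
    refine ⟨F 1, ?_⟩
    rw [hx]
    apply le_antisymm
    · rw [Ideal.span_le, Set.singleton_subset_iff]; exact (f _).2
    · intro w hw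
      obtain ⟨⟨v, hv⟩, hvw⟩ := hf ⟨w, hw⟩
      have hv' := hv
      rw [← g.span_eq i] at hv'
      obtain ⟨c, rfl⟩ := Ideal.mem_span_singleton'.1 hv'
      refine Ideal.mem_span_singleton'.2 ⟨c, ?_⟩
      have : (⟨c * g.x i, hv⟩ : J i) = c • ⟨g.x i, g.mem i⟩ := rfl
      rw [this, map_smul] at hvw
      exact congrArg Subtype.val hvw
  choose! b hb using hex
  have hmem := h.mem_span (y := fun k => g.x i * b k) hb (h.le_of_le hij (g.mem j))
  have hsub : Submodule.span K ((fun k => g.x i * b k) '' Set.Ici i) ≤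
      LinearMap.range (LinearMap.mulLeft K (g.x i)) := by
    rw [Submodule.span_le]
    rintro _ ⟨k, -, rfl⟩
    exact ⟨b k, rfl⟩
  exact hsub hmem

/-- An element `b ∈ B` with `x i · b = x j`, where `i ≤ j`. -/
noncomputable def factor [IsAlgClosed K] [FiniteDimensional K B] (h : SatisfiesLE K J o)
    (g : Generators J o) {i j : Λ} (hij : i ≤ j) : B :=
  (h.exists_mul_eq g hij).choose

theorem mul_factor [IsAlgClosed K] [FiniteDimensional K B] (h : SatisfiesLE K J o)
    (g : Generators J o) {i j : Λ} (hij : i ≤ j) : g.x i * h.factor g hij = g.x j :=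
  (h.exists_mul_eq g hij).choose_spec

theorem mul_factor_mem [IsAlgClosed K] [FiniteDimensional K B] (h : SatisfiesLE K J o)
    (g : Generators J o) {i j : Λ} (hij : i ≤ j) {y : B} (hy : y ∈ J i) :
    LinearMap.toSpanSingleton B B (h.factor g hij) y ∈ J j := by
  rw [← g.span_eq i] at hy
  obtain ⟨c, rfl⟩ := Ideal.mem_span_singleton'.1 hy
  rw [LinearMap.toSpanSingleton_apply, smul_eq_mul, mul_assoc, h.mul_factor g hij]
  exact (J j).mul_mem_left c (g.mem j)

/-- For `i ≤ j`, the surjection `J i → J j`, `y ↦ y · b`, where `x i · b = x j`; it is the only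
`B`-linear map that takes `x i` to `x j`. -/
noncomputable def surj [IsAlgClosed K] [FiniteDimensional K B] (h : SatisfiesLE K J o)
    (g : Generators J o) {i j : Λ} (hij : i ≤ j) : J i →ₗ[B] J j :=
  (LinearMap.toSpanSingleton B B (h.factor g hij)).restrict fun _ hy => h.mul_factor_mem g hij hy

/-- For `j ≤ i`, the inclusion of `J i` into `J j`. -/
def incl (h : SatisfiesLE K J o) {i j : Λ} (hji : j ≤ i) : J i →ₗ[B] J j :=
  Submodule.inclusion (h.le_of_le hji)

end SatisfiesLE

end Condition

/-! ### The quiver and the presentation of `A` -/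

section Presentation

/-- The vertices of the quiver of the incidence algebra of a poset. -/
def HasseQuiver (Λ : Type*) : Type _ := Λ

/-- There is exactly one arrow from `i` to `j` if `i` is a small neighbour of `j` (that is, `j`
covers `i`), and none otherwise. -/
instance (Λ : Type*) [PartialOrder Λ] : Quiver (HasseQuiver Λ) :=
  ⟨fun i j : Λ => PLift (i ⋖ j)⟩

/-- The double of the quiver of the incidence algebra: for neighbours `i`, `j` there is exactly
one arrow from `i` to `j` and exactly one arrow from `j` to `i`. -/
abbrev DoubleQuiver (Λ : Type*) : Type _ := Quiver.Symmetrify (HasseQuiver Λ)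

instance (Λ : Type*) [h : Fintype Λ] : Fintype (DoubleQuiver Λ) := h

instance (Λ : Type*) [h : DecidableEq Λ] : DecidableEq (DoubleQuiver Λ) := h

variable {K : Type*} [Field K] [IsAlgClosed K] {B : Type*} [Ring B] [Algebra K B]
  [FiniteDimensional K B] {Λ : Type*} [Fintype Λ] [DecidableEq Λ] [PartialOrder Λ]
  {J : Λ → Ideal B} {o : Λ}

/-- The family `J`, indexed by the vertices of the quiver. -/
def idealAt (J : Λ → Ideal B) : DoubleQuiver Λ → Ideal B := J

/-- The `B`-map of an arrow `i → j`: the surjection `J i → J j` with `x i ↦ x j` if `j` covers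
`i`, and the inclusion of `J i` into `J j` if `i` covers `j`. -/
noncomputable def arrowMap (h : SatisfiesLE K J o) (g : Generators J o) (i j : DoubleQuiver Λ) :
    (i ⟶ j) → (idealAt J i →ₗ[B] idealAt J j)
  | Sum.inl a => h.surj g a.down.le
  | Sum.inr a => h.incl a.down.le

/-- The presentation `KQ → A` of an algebra `A ≅ End_B(L)ᵒᵖ`, `L ≅ ⨁ i, J i`, by the maps
`arrowMap`. -/
noncomputable def presentation (h : SatisfiesLE K J o) (g : Generators J o)
    {L : Type*} [AddCommGroup L] [Module B L] [Module K L] [IsScalarTower K B L]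
    (eL : L ≃ₗ[B] ((i : Λ) → J i))
    {A : Type*} [Ring A] [Algebra K A] (eA : A ≃ₐ[K] Module.End B L) :
    PathAlgebra K (DoubleQuiver Λ) →ₐ[K] A :=
  presentationOf K (M := fun i : DoubleQuiver Λ => idealAt J i) (arrowMap h g) eL eA

end Presentation

end BGGReversal

namespace BGGReversal

open Quiver

/-! ### The basis of generators -/

section Basis

variable {K : Type*} [Field K] [IsAlgClosed K] {B : Type*} [Ring B] [Algebra K B]
  [FiniteDimensional K B] {Λ : Type*} [Fintype Λ] [PartialOrder Λ] {J : Λ → Ideal B} {o : Λ}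

namespace SatisfiesLE

/-! The generators `x i` span `B` and are as many as its dimension, so they form a `K`-basis, and `J
i ∩ J j` has as basis the `x k` with `k ≥ i` and `k ≥ j`. By self-injectivity every map `J i → J j`
is a right multiplication; since `J i` is two-sided, the image of `x i` lies in `J i ∩ J j`. Each
such `x k` is the value of the path that climbs from `i` to `k` and descends to `j` by inclusions.
Hence paths realise all matrix entries and `ψ` is surjective (`evalHom_surjective`).

Conditions (ii) and (iii) both say that the reversal `ε` of paths preserves `I = ker ψ`. If `B` is
commutative, a path and its opposite have the same value (`pathValue_reverse`), so `ε` transposes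
the matrix of values and preserves `I`. Conversely, the loop `q k` at `o` that climbs to `k` and
returns is its own opposite and acts as right multiplication by `x k` (`exists_symmetric_loop`).
Expanding `x k * x l` in the basis gives an element of `I`; its reversal forces `x l * x k = x k * x
l` (`forall_mul_comm_iff`). -/

theorem top_le_span_generators (h : SatisfiesLE K J o) (g : Generators J o) :
    ⊤ ≤ Submodule.span K (Set.range g.x) := fun z _ =>
  Submodule.span_mono (Set.image_subset_range _ _)
    (h.mem_span (i := o) (fun k _ => g.span_eq k) (by rw [h.eq_top]; trivial))

/-- The generators `x i` form a `K`-basis of `B`. -/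
noncomputable def generatorBasis (h : SatisfiesLE K J o) (g : Generators J o) :
    Module.Basis Λ K B :=
  basisOfTopLeSpanOfCardEqFinrank g.x (h.top_le_span_generators g) h.finrank_eq.symm

theorem coe_generatorBasis (h : SatisfiesLE K J o) (g : Generators J o) :
    ⇑(h.generatorBasis g) = g.x :=
  coe_basisOfTopLeSpanOfCardEqFinrank _ _ _

theorem support_repr_subset (h : SatisfiesLE K J o) (g : Generators J o) {i : Λ} {z : B}
    (hz : z ∈ J i) : (((h.generatorBasis g).repr z).support : Set Λ) ⊆ Set.Ici i := by
  rw [← Module.Basis.mem_span_image, coe_generatorBasis]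
  exact h.mem_span (fun k _ => g.span_eq k) hz

/-- By linear independence, `x k` can lie in the span of the `x m` with `m ≥ o` only if `k` is one
of these `m`. This supplies an ascending path from `o` to every vertex. -/
theorem bot_le (h : SatisfiesLE K J o) (g : Generators J o) (k : Λ) : o ≤ k := by
  have hk : g.x k ∈ J o := by rw [h.eq_top]; trivial
  have hsub := h.support_repr_subset g hk
  rw [← h.coe_generatorBasis g, Module.Basis.repr_self] at hsub
  exact hsub (by simp)

/-- Coordinates in a basis are unique, so the two restrictions on the support of `z` hold
simultaneously. -/
theorem mem_span_of_mem_inf (h : SatisfiesLE K J o) (g : Generators J o) {i j : Λ} {z : B}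
    (hi : z ∈ J i) (hj : z ∈ J j) : z ∈ Submodule.span K (g.x '' {k | i ≤ k ∧ j ≤ k}) := by
  rw [← h.coe_generatorBasis g, Module.Basis.mem_span_image]
  exact fun k hk => ⟨h.support_repr_subset g hi hk, h.support_repr_subset g hj hk⟩

omit [IsAlgClosed K] [FiniteDimensional K B] in
/-- By self-injectivity, a map from a left ideal to another is a right multiplication. -/
theorem exists_eq_mul_right (h : SatisfiesLE K J o) {I I' : Ideal B} (f : I →ₗ[B] I') :
    ∃ b : B, ∀ y : I, (f y : B) = y * b := by
  obtain ⟨F, hF⟩ := h.selfInjective.out I.subtype Subtype.val_injective (I'.subtype.comp f)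
  refine ⟨F 1, fun y => ?_⟩
  rw [← smul_eq_mul, ← map_smul, smul_eq_mul, mul_one]
  exact (hF y).symm

omit [IsAlgClosed K] [FiniteDimensional K B] in
-- A right multiplication cannot leave a two-sided ideal. The values of a map `J i → J j` thus lie
-- in `J i ∩ J j`.
theorem coe_map_mem (h : SatisfiesLE K J o) {i : Λ} {I' : Ideal B} (f : J i →ₗ[B] I') (y : J i) :
    (f y : B) ∈ J i := by
  obtain ⟨b, hb⟩ := h.exists_eq_mul_right f
  have := h.isTwoSided i
  rw [hb]
  exact (J i).mul_mem_right b y.2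

end SatisfiesLE

end Basis

/-! ### Values of paths -/

section Vertices

variable {B : Type*} [Ring B] {Λ : Type*} {J : Λ → Ideal B} {o : Λ}

/-- An element of `Λ`, as a vertex of the quiver. -/
def vertex (i : Λ) : DoubleQuiver Λ := i

/-- The generator `x i`, as an element of the ideal at the vertex `i`. -/
def Generators.gen (g : Generators J o) (i : DoubleQuiver Λ) : idealAt J i := ⟨g.x i, g.mem i⟩

theorem Generators.coe_gen_vertex (g : Generators J o) (i : Λ) :
    (g.gen (vertex i) : B) = g.x i := rfl

theorem Generators.coe_gen_bot (g : Generators J o) : (g.gen (vertex o) : B) = 1 := g.x_one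

theorem Generators.exists_smul_gen (g : Generators J o) {i : DoubleQuiver Λ} (y : idealAt J i) :
    ∃ b : B, y = b • g.gen i := by
  obtain ⟨b, hb⟩ := Ideal.mem_span_singleton'.1 ((g.span_eq i).ge y.2)
  exact ⟨b, Subtype.ext hb.symm⟩

end Vertices

section Paths

variable {K : Type*} [Field K] [IsAlgClosed K] {B : Type*} [Ring B] [Algebra K B]
  [FiniteDimensional K B] {Λ : Type*} [Fintype Λ] [PartialOrder Λ] {J : Λ → Ideal B} {o : Λ}

/-- The image of `x i` under the map of a path that starts at `i`. -/
noncomputable def pathValue (h : SatisfiesLE K J o) (g : Generators J o) {i j : DoubleQuiver Λ}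
    (p : Path i j) : B :=
  (pathMap (arrowMap h g) p (g.gen i) : B)

/-- An ascending path from `i` to `k` maps `x i` to `x k`, and its opposite is an inclusion. -/
theorem exists_ascending_path (h : SatisfiesLE K J o) (g : Generators J o) {i k : Λ}
    (hik : i ≤ k) : ∃ p : Path (vertex i) (vertex k),
      pathMap (arrowMap h g) p (g.gen (vertex i)) = g.gen (vertex k) ∧
      ∀ y, (pathMap (arrowMap h g) p.reverse y : B) = y := by
  classical
  -- In a finite poset `≤` is the reflexive transitive closure of covering, so the path is built one
  -- arrow at a time.
  let _ : LocallyFiniteOrder Λ := Fintype.toLocallyFiniteOrder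
  have hrel := le_iff_reflTransGen_covBy.1 hik
  clear hik
  induction hrel with
  | refl => exact ⟨Path.nil, rfl, fun y => rfl⟩
  | @tail j k _ hjk ih =>
    obtain ⟨p, hp, hp'⟩ := ih
    let a : vertex j ⟶ vertex k := Sum.inl (PLift.up hjk)
    refine ⟨p.cons a, ?_, fun y => ?_⟩
    · rw [pathMap, LinearMap.comp_apply, hp]
      exact Subtype.ext (h.mul_factor g hjk.le)
    -- The opposite path starts with the reversed last arrow, which is an inclusion and does not
    -- change `y`.
    · rw [Path.reverse, pathMap_comp]
      exact hp' _

/-- Induction on the last arrow `j → k`, with the opposite of the shorter path written as right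
multiplication by some `c`. For an ascending arrow, `c` has to be moved past the factor that takes
`x j` to `x k`; this is where commutativity enters. -/
theorem pathValue_reverse (h : SatisfiesLE K J o) (g : Generators J o)
    (hB : ∀ a b : B, a * b = b * a) {i j : DoubleQuiver Λ} (p : Path i j) :
    pathValue h g p.reverse = pathValue h g p := by
  induction p with
  | nil => rfl
  | @cons j k p a ih =>
    obtain ⟨c, hc⟩ := h.exists_eq_mul_right (pathMap (arrowMap h g) p.reverse)
    have e : pathValue h g (p.cons a).reverse =
        (arrowMap h g k j (Quiver.reverse a) (g.gen k) : B) * c := by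
      rw [pathValue, Path.reverse, pathMap_comp]
      exact hc _
    have e' : pathValue h g p = (g.gen j : B) * c := by rw [← ih]; exact hc _
    rw [e]
    rcases a with a | a
    · have hx : (g.gen j : B) * h.factor g a.down.le = (g.gen k : B) := h.mul_factor g a.down.le
      change (g.gen k : B) * c = pathValue h g p * h.factor g a.down.le
      rw [e', mul_assoc, hB c, ← mul_assoc, hx]
    · have hx : (g.gen k : B) * h.factor g a.down.le = (g.gen j : B) := h.mul_factor g a.down.le
      change (g.gen k : B) * h.factor g a.down.le * c = pathValue h g p
      rw [e', hx]

end Paths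

/-! ### Matrix entries of endomorphisms -/

section Entries

variable {K : Type*} [Field K] [IsAlgClosed K] {B : Type*} [Ring B] [Algebra K B]
  [FiniteDimensional K B] {Λ : Type*} [Fintype Λ] [DecidableEq Λ] [PartialOrder Λ]
  {J : Λ → Ideal B} {o : Λ}

/-- The component in `J j` of the image of `x i`. -/
def entry (K : Type*) [Field K] [Algebra K B] (g : Generators J o) (i j : DoubleQuiver Λ) :
    Module.End B ((i : DoubleQuiver Λ) → idealAt J i) →ₗ[K] B where
  toFun F := (F (Pi.single i (g.gen i)) j : B)
  map_add' _ _ := rfl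
  map_smul' _ _ := rfl

omit [IsAlgClosed K] [FiniteDimensional K B] [Fintype Λ] [PartialOrder Λ] in
theorem entry_apply (g : Generators J o) (i j : DoubleQuiver Λ)
    (F : Module.End B ((i : DoubleQuiver Λ) → idealAt J i)) :
    entry K g i j F = (F (Pi.single i (g.gen i)) j : B) := rfl

omit [IsAlgClosed K] [FiniteDimensional K B] [PartialOrder Λ] in
-- Each summand is cyclic, generated by `x i`, so an endomorphism is determined by its matrix of
-- values on the generators.
theorem ext_entry (g : Generators J o)
    {F G : Module.End B ((i : DoubleQuiver Λ) → idealAt J i)}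
    (hFG : ∀ i j, entry K g i j F = entry K g i j G) : F = G := by
  refine LinearMap.pi_ext fun i y => ?_
  obtain ⟨b, rfl⟩ := g.exists_smul_gen y
  rw [Pi.single_smul, map_smul, map_smul]
  congr 1
  exact funext fun j => Subtype.ext (hFG i j)

theorem entry_evalHom_ofPath (h : SatisfiesLE K J o) (g : Generators J o)
    {k l : DoubleQuiver Λ} (p : Path k l) (i j : DoubleQuiver Λ) :
    entry K g i j (evalHom K (arrowMap h g) (PathAlgebra.ofPath K ⟨k, l, p⟩)) =
      if k = i ∧ l = j then pathValue h g p else 0 := by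
  have e : evalHom K (arrowMap h g) (PathAlgebra.ofPath K ⟨k, l, p⟩) =
      pathEnd (arrowMap h g) ⟨k, l, p⟩ := evalLin_ofPath K _ _
  rw [e, entry_apply]
  by_cases hk : k = i
  · subst hk
    by_cases hl : l = j
    · subst hl
      simp [pathEnd, pathValue]
    · simp [pathEnd, hl]
  · simp [pathEnd, hk]

/-- By linearity it suffices to treat `z = x k`, which is the value of the path that climbs from `i`
to `k` and descends to `j`. -/
theorem exists_evalHom_entry (h : SatisfiesLE K J o) (g : Generators J o)
    {i j : Λ} {z : B} (hz : z ∈ Submodule.span K (g.x '' {k | i ≤ k ∧ j ≤ k})) :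
    ∃ ρ : PathAlgebra K (DoubleQuiver Λ), ∀ i' j',
      entry K g i' j' (evalHom K (arrowMap h g) ρ) =
        if vertex i = i' ∧ vertex j = j' then z else 0 := by
  induction hz using Submodule.span_induction with
  | mem z hz =>
    obtain ⟨k, ⟨hik, hjk⟩, rfl⟩ := hz
    obtain ⟨p, hp, -⟩ := exists_ascending_path h g hik
    obtain ⟨q, -, hq⟩ := exists_ascending_path h g hjk
    refine ⟨PathAlgebra.ofPath K ⟨vertex i, vertex j, p.comp q.reverse⟩, fun i' j' => ?_⟩
    have e : pathValue h g (p.comp q.reverse) = g.x k := by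
      rw [pathValue, pathMap_comp, LinearMap.comp_apply, hp, hq, g.coe_gen_vertex]
    rw [entry_evalHom_ofPath, e]
  | zero => exact ⟨0, fun i' j' => by simp⟩
  | add a b _ _ ha hb =>
    obtain ⟨ρ, hρ⟩ := ha
    obtain ⟨τ, hτ⟩ := hb
    refine ⟨ρ + τ, fun i' j' => ?_⟩
    rw [map_add, map_add, hρ, hτ]
    split_ifs <;> simp
  | smul c a _ ha =>
    obtain ⟨ρ, hρ⟩ := ha
    refine ⟨c • ρ, fun i' j' => ?_⟩
    rw [map_smul, map_smul, hρ]
    split_ifs <;> simp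

theorem evalHom_surjective (h : SatisfiesLE K J o) (g : Generators J o) :
    Function.Surjective (evalHom K (arrowMap h g)) := by
  intro F
  have hmem : ∀ i j : Λ, entry K g (vertex i) (vertex j) F ∈
      Submodule.span K (g.x '' {k | i ≤ k ∧ j ≤ k}) := fun i j => by
    -- The `(i, j)` block of `F`: its value at `x i` lies in `J j` as its codomain, and in `J i` by
    -- `coe_map_mem`.
    let f : J i →ₗ[B] J j := (LinearMap.proj (vertex j)).comp
      (F.comp (LinearMap.single B (fun i : DoubleQuiver Λ => idealAt J i) (vertex i)))
    exact h.mem_span_of_mem_inf g (h.coe_map_mem f (g.gen (vertex i)))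
      (f (g.gen (vertex i))).2
  have hF : ∀ i j : DoubleQuiver Λ, ∃ ρ : PathAlgebra K (DoubleQuiver Λ), ∀ i' j',
      entry K g i' j' (evalHom K (arrowMap h g) ρ) =
        if i = i' ∧ j = j' then entry K g i j F else 0 := fun i j =>
    exists_evalHom_entry h g (hmem i j)
  choose ρ hρ using hF
  -- Each `ρ i j` realises one entry of `F` and is zero in all the others, so the sum realises `F`.
  refine ⟨∑ i, ∑ j, ρ i j, ext_entry (K := K) g fun i' j' => ?_⟩
  simp only [map_sum, hρ]
  rw [Finset.sum_eq_single i' (fun i _ hi => by simp [hi]) (by simp),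
    Finset.sum_eq_single j' (fun j _ hj => by simp [hj]) (by simp)]
  simp

end Entries

/-! ### The reversal of paths -/

section Reversal

variable {K : Type*} [Field K] {V : Type*} [Quiver V]

theorem reversal_ofPath [HasReverse V] (p : AnyPath V) :
    reversal K V (PathAlgebra.ofPath K p) = PathAlgebra.ofPath K (oppPath p) := by
  simp [reversal, PathAlgebra.ofPath]

theorem reversal_reversal [HasInvolutiveReverse V] (ρ : PathAlgebra K V) :
    reversal K V (reversal K V ρ) = ρ := by
  induction ρ using PathAlgebra.induction_paths with
  | zero => simp
  | add a b ha hb => rw [map_add, map_add, ha, hb]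
  | smul c p => simp [reversal_ofPath, oppPath]

theorem reversal_mul [HasReverse V] [Fintype V] (ρ τ : PathAlgebra K V) :
    reversal K V (ρ * τ) = reversal K V τ * reversal K V ρ := by
  induction ρ using PathAlgebra.induction_paths with
  | zero => simp
  | add a b ha hb => rw [add_mul, map_add, map_add, mul_add, ha, hb]
  | smul c p =>
    induction τ using PathAlgebra.induction_paths with
    | zero => simp
    | add a b ha hb => rw [mul_add, map_add, map_add, add_mul, ha, hb]
    | smul d q =>
      simp only [smul_mul_assoc, mul_smul_comm, map_smul, reversal_ofPath,
        PathAlgebra.ofPath_mul_ofPath]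
      rw [smul_comm]
      congr 2
      obtain ⟨i, j, p⟩ := p
      obtain ⟨k, l, q⟩ := q
      by_cases hl : l = i
      · subst hl
        simp only [PathAlgebra.mulPath_comp, reversal_ofPath, oppPath, Path.reverse_comp]
      · rw [PathAlgebra.mulPath_of_ne (by exact hl), map_zero,
          PathAlgebra.mulPath_of_ne (by exact Ne.symm hl)]

/-- The reversal of paths preserves the kernel of `ψ` if and only if it induces an
anti-automorphism. -/
theorem reversalInducesAntiAutomorphism_iff [Fintype V] [HasInvolutiveReverse V] {A : Type*}
    [Ring A] [Algebra K A] {ψ : PathAlgebra K V →ₐ[K] A} (hψ : Function.Surjective ψ) :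
    ReversalInducesAntiAutomorphism ψ ↔ ∀ ρ, ψ ρ = 0 → ψ (reversal K V ρ) = 0 := by
  constructor
  · rintro ⟨σ, -, -, hσ⟩ ρ hρ
    rw [← hσ, hρ, map_zero]
  · intro hker
    -- `ψ ∘ ε` vanishes on the kernel of `ψ`, so it factors through `KQ / ker ψ ≅ A`; the
    -- factorisation is `σ`.
    have hle : ψ.toLinearMap.ker ≤ (ψ.toLinearMap.comp (reversal K V)).ker := hker
    let e := ψ.toLinearMap.quotKerEquivOfSurjective hψ
    let σ : A →ₗ[K] A :=
      (ψ.toLinearMap.ker.liftQ (ψ.toLinearMap.comp (reversal K V)) hle).comp e.symm.toLinearMap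
    have hσ : ∀ ρ, σ (ψ ρ) = ψ (reversal K V ρ) := by
      intro ρ
      have he : e.symm (ψ ρ) = Submodule.Quotient.mk ρ := by
        rw [LinearEquiv.symm_apply_eq]
        rfl
      change Submodule.liftQ _ _ hle (e.symm (ψ ρ)) = _
      rw [he]
      rfl
    refine ⟨σ, fun a a' => ?_, fun a => ?_, hσ⟩
    · obtain ⟨ρ, rfl⟩ := hψ a
      obtain ⟨τ, rfl⟩ := hψ a'
      rw [← map_mul, hσ, hσ, hσ, reversal_mul, map_mul]
    · obtain ⟨ρ, rfl⟩ := hψ a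
      rw [hσ, hσ, reversal_reversal]

theorem forall_sum_mem_ker_iff [Fintype V] [HasInvolutiveReverse V] {A : Type*} [Ring A]
    [Algebra K A] (ψ : PathAlgebra K V →ₐ[K] A) :
    (∀ (r : ℕ) (c : Fin r → K) (p : Fin r → AnyPath V),
      ∑ t, c t • PathAlgebra.ofPath K (p t) ∈ RingHom.ker ψ ↔
        ∑ t, c t • PathAlgebra.ofPath K (oppPath (p t)) ∈ RingHom.ker ψ) ↔
      ∀ ρ, ψ ρ = 0 → ψ (reversal K V ρ) = 0 := by
  have hrev : ∀ (r : ℕ) (c : Fin r → K) (p : Fin r → AnyPath V),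
      ∑ t, c t • PathAlgebra.ofPath K (oppPath (p t)) =
        reversal K V (∑ t, c t • PathAlgebra.ofPath K (p t)) := by
    intro r c p
    simp only [map_sum, map_smul, reversal_ofPath]
  simp only [hrev, RingHom.mem_ker]
  constructor
  · intro H ρ hρ
    obtain ⟨r, c, p, rfl⟩ : ∃ (r : ℕ) (c : Fin r → K) (p : Fin r → AnyPath V),
        ρ = ∑ t, c t • PathAlgebra.ofPath K (p t) := by
      let b := PathAlgebra.basis K V
      let e := (b.repr ρ).support.equivFin
      refine ⟨_, fun t => b.repr ρ (e.symm t), fun t => (e.symm t : AnyPath V), ?_⟩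
      conv_lhs => rw [← b.linearCombination_repr ρ, Finsupp.linearCombination_apply, Finsupp.sum,
        ← Finset.sum_coe_sort]
      exact (Equiv.sum_comp e.symm
        fun s : (b.repr ρ).support => b.repr ρ s • b (s : AnyPath V)).symm
    exact (H r c p).1 hρ
  · intro H r c p
    -- As `ε` is an involution, the converse is the same implication applied to the reversed
    -- element.
    refine ⟨H _, fun hρ => ?_⟩
    rw [← reversal_reversal (∑ t, c t • PathAlgebra.ofPath K (p t))]
    exact H _ hρ

end Reversal

/-! ### Commutativity and the reversal of paths -/

section Commutativity

variable {K : Type*} [Field K] [IsAlgClosed K] {B : Type*} [Ring B] [Algebra K B]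
  [FiniteDimensional K B] {Λ : Type*} [Fintype Λ] [DecidableEq Λ] [PartialOrder Λ]
  {J : Λ → Ideal B} {o : Λ}

theorem entry_evalHom_reversal (h : SatisfiesLE K J o) (g : Generators J o)
    (hB : ∀ a b : B, a * b = b * a) (ρ : PathAlgebra K (DoubleQuiver Λ))
    (i j : DoubleQuiver Λ) :
    entry K g i j (evalHom K (arrowMap h g) (reversal K _ ρ)) =
      entry K g j i (evalHom K (arrowMap h g) ρ) := by
  induction ρ using PathAlgebra.induction_paths with
  | zero => simp
  | add a b ha hb => simp only [map_add, ha, hb]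
  | smul c p =>
    obtain ⟨k, l, p⟩ := p
    simp only [map_smul, reversal_ofPath, oppPath, entry_evalHom_ofPath,
      pathValue_reverse h g hB, and_comm]

omit [DecidableEq Λ] in
/-- There is a loop at `o` of value `x k` that is equal to its opposite. -/
theorem exists_symmetric_loop (h : SatisfiesLE K J o) (g : Generators J o) (k : Λ) :
    ∃ p : Path (vertex o) (vertex o), p.reverse = p ∧
      ∀ y, (pathMap (arrowMap h g) p y : B) = y * g.x k := by
  obtain ⟨p, hp, hp'⟩ := exists_ascending_path h g (h.bot_le g k)
  refine ⟨p.comp p.reverse, by rw [Path.reverse_comp, Path.reverse_reverse], fun y => ?_⟩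
  -- The generator at `o` is `1`, so the factor `b` of the ascending path is the image of `1`, which
  -- is `x k`.
  obtain ⟨b, hb⟩ := h.exists_eq_mul_right (pathMap (arrowMap h g) p)
  have hbk : b = g.x k := by
    have := hb (g.gen (vertex o))
    rw [hp, g.coe_gen_vertex, g.coe_gen_bot, one_mul] at this
    exact this.symm
  rw [pathMap_comp, LinearMap.comp_apply, hp', hb, hbk]

theorem forall_mul_comm_iff (h : SatisfiesLE K J o) (g : Generators J o) :
    (∀ a b : B, a * b = b * a) ↔ ∀ ρ, evalHom K (arrowMap h g) ρ = 0 →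
      evalHom K (arrowMap h g) (reversal K (DoubleQuiver Λ) ρ) = 0 := by
  constructor
  · intro hB ρ hρ
    refine ext_entry (K := K) g fun i j => ?_
    rw [entry_evalHom_reversal h g hB, hρ, map_zero, map_zero]
  · intro H
    choose q hq hval using exists_symmetric_loop (K := K) h g
    let b := h.generatorBasis g
    have hb : ∀ k, b k = g.x k := fun k => congrFun (h.coe_generatorBasis g) k
    have hvalue : ∀ k, pathValue h g (q k) = g.x k := fun k => by
      rw [pathValue, hval, g.coe_gen_bot, one_mul]
    have hvalue₂ : ∀ k l, pathValue h g ((q k).comp (q l)) = g.x k * g.x l := fun k l => by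
      rw [pathValue, pathMap_comp, LinearMap.comp_apply, hval, hval, g.coe_gen_bot, one_mul]
    have hcomm : ∀ k l, g.x k * g.x l = g.x l * g.x k := by
      intro k l
      have hsum : g.x k * g.x l = ∑ m, b.repr (g.x k * g.x l) m • g.x m := by
        simp only [← hb]
        exact (b.sum_repr _).symm
      -- The relation `x k * x l = ∑ c m • x m`, lifted to loops at `o`. Reversal fixes each `q m`
      -- and only exchanges the order of `q k` and `q l`.
      have hrev := H (PathAlgebra.ofPath K ⟨vertex o, vertex o, (q k).comp (q l)⟩ -
        ∑ m, b.repr (g.x k * g.x l) m • PathAlgebra.ofPath K ⟨vertex o, vertex o, q m⟩) (by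
          refine ext_entry (K := K) g fun i j => ?_
          simp only [map_sub, map_sum, map_smul, entry_evalHom_ofPath, hvalue, hvalue₂, map_zero]
          split_ifs
          · rw [← hsum, sub_self]
          · simp)
      have hentry := congrArg (entry K g (vertex o) (vertex o)) hrev
      simp only [map_sub, map_sum, map_smul, reversal_ofPath, oppPath, Path.reverse_comp, hq,
        entry_evalHom_ofPath, hvalue, hvalue₂, map_zero, and_self, if_true] at hentry
      rw [← hsum, sub_eq_zero] at hentry
      exact hentry.symm
    intro x y
    -- The product and its flip are bilinear, so agreement on the basis suffices.
    have hmul : LinearMap.mul K B = (LinearMap.mul K B).flip :=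
      b.ext fun k => b.ext fun l => by simpa [hb] using hcomm k l
    exact LinearMap.congr_fun₂ hmul x y

end Commutativity

end BGGReversal

theorem theoremB {K : Type*} [Field K] [IsAlgClosed K]
    {B : Type*} [Ring B] [Algebra K B] [FiniteDimensional K B]
    {Λ : Type*} [Fintype Λ] [DecidableEq Λ] [PartialOrder Λ] {o : Λ} {J : Λ → Ideal B}
    (h : BGGReversal.SatisfiesLE K J o) (g : BGGReversal.Generators J o)
    {L : Type*} [AddCommGroup L] [Module B L] [Module K L] [IsScalarTower K B L]
    (eL : L ≃ₗ[B] ((i : Λ) → J i))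
    {A : Type*} [Ring A] [Algebra K A] (eA : A ≃ₐ[K] Module.End B L) :
    Function.Surjective (BGGReversal.presentation h g eL eA) ∧
    List.TFAE [
      ∀ a b : B, a * b = b * a,
      BGGReversal.ReversalInducesAntiAutomorphism (BGGReversal.presentation h g eL eA),
      ∀ (r : ℕ) (c : Fin r → K)
        (p : Fin r → BGGReversal.AnyPath (BGGReversal.DoubleQuiver Λ)),
        ∑ t, c t • BGGReversal.PathAlgebra.ofPath K (p t) ∈
            RingHom.ker (BGGReversal.presentation h g eL eA) ↔
          ∑ t, c t • BGGReversal.PathAlgebra.ofPath K (BGGReversal.oppPath (p t)) ∈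
            RingHom.ker (BGGReversal.presentation h g eL eA)] := by
  open BGGReversal in
  have hsurj : Function.Surjective (presentation h g eL eA) :=
    (eA.trans (eL.conjAlgEquiv K)).symm.surjective.comp (evalHom_surjective h g)
  -- `presentation` is `evalHom` followed by an algebra isomorphism, so the two have the same
  -- kernel.
  have hzero : ∀ ρ, presentation h g eL eA ρ = 0 ↔ evalHom K (arrowMap h g) ρ = 0 :=
    fun ρ => map_eq_zero_iff (eA.trans (eL.conjAlgEquiv K)).symm
      (eA.trans (eL.conjAlgEquiv K)).symm.injective
  have hcomm := forall_mul_comm_iff h g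
  simp only [← hzero] at hcomm
  refine ⟨hsurj, ?_⟩
  tfae_have 1 ↔ 2 := hcomm.trans (reversalInducesAntiAutomorphism_iff hsurj).symm
  tfae_have 1 ↔ 3 := hcomm.trans (forall_sum_mem_ker_iff _).symm
  tfae_finish
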